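/- Let $n\ge 0$ and let $\mathfrak S_n$ be the set of permutations $\pi=a_1a_2\cdots a_n$ of $1,\dots,n$, with length $\ell(\pi)=\#\{i<j : a_i>a_j\}$. Order $\mathfrak S_n$ by the weak (Bruhat) order: the partial order generated by $\pi<\pi s_i$ whenever $s_i=(i,i+1)$, $1\le i<n$, and $\ell(\pi s_i)>\ell(\pi)$, where $\pi s_i$ is obtained from $\pi$ by exchanging the letters in positions $i$ and $i+1$. Let $w_0=n,n-1,\dots,1$. For $\pi\in\mathfrak S_n$ let $\Lambda_\pi=[\mathrm{id},\pi]$ and $V_\pi=[\pi,w_0]$ be intervals in this order, and let $$F(\Lambda_\pi,q)=\sum_{\sigma\in\Lambda_\pi}q^{\ell(\sigma)},\qquad F(V_\pi,q)=\sum_{\sigma\in V_\pi}q^{\ell(\sigma)-\ell(\pi)}$$ be their rank generating functions. Call $\pi=a_1\cdots a_n$ separable if there are no $i<j<k<h$ with $a_j<a_h<a_i<a_k$ or $a_k<a_i<a_h<a_j$ (that is, $\pi$ avoids the patterns $3142$ and $2413$). If $\pi$ is separable, then the polynomials $F(\Lambda_\pi,q)$ and $F(V_\pi,q)$ are symmetric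 and unimodal, where a polynomial $c_0+c_1q+\cdots+c_dq^d$ of degree $d$ is symmetric if $c_i=c_{d-i}$ for $0\le i\le d$, and unimodal if $c_0\le\cdots\le c_j\ge\cdots\ge c_d$ for some $j$. Moreover, $\Lambda_\pi$ and $V_\pi$ are rank-symmetric and rank-unimodal graded posets: in each of them, with rank function $\sigma\mapsto\ell(\sigma)$ on $\Lambda_\pi$ and $\sigma\mapsto\ell(\sigma)-\ell(\pi)$ on $V_\pi$, and with $N$ the largest rank of an element, all maximal chains have exactly $N+1$ elements, and the numbers $p_i$ of elements of rank $i$ satisfy $p_i=p_{N-i}$ for $0\le i\le N$ and $p_0\le\cdots\le p_j\ge\cdots\ge p_N$ for some $j$. -/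

import Mathlib

open Polynomial

/-! Permutations of `n` letters are elements `π : Equiv.Perm (Fin n)`, with one-line notation
`π 0, π 1, …, π (n - 1)` (letters and positions are numbered from `0`). The product is composition
from right to left, so `π * swap i (i + 1)` exchanges the letters in the positions `i`, `i + 1`. -/

/-- The inversions of `π`, as pairs of positions. -/
def inversions {n : ℕ} (π : Equiv.Perm (Fin n)) : Finset (Fin n × Fin n) :=
  Finset.univ.filter fun p => p.1 < p.2 ∧ π p.2 < π p.1

/-- The length of a permutation: its number of inversions. -/
def permLength {n : ℕ} (π : Equiv.Perm (Fin n)) : ℕ := (inversions π).card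

/-- `σ = π s_i` for an adjacent transposition `s_i = (i, i + 1)`, and `σ` is longer than `π`. -/
def WeakStep {n : ℕ} (π σ : Equiv.Perm (Fin n)) : Prop :=
  (∃ (i : ℕ) (h : i + 1 < n), σ = π * Equiv.swap ⟨i, by omega⟩ ⟨i + 1, h⟩) ∧
    permLength π < permLength σ

theorem permLength_le_of_reflTransGen {n : ℕ} {π σ : Equiv.Perm (Fin n)}
    (h : Relation.ReflTransGen WeakStep π σ) : permLength π ≤ permLength σ := by
  induction h with
  | refl => exact le_rfl
  | tail _ h ih => exact ih.trans h.2.le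

/-- The weak (Bruhat) order: the partial order generated by the steps `π → π s_i` that increase
the length. -/
instance weakOrder (n : ℕ) : PartialOrder (Equiv.Perm (Fin n)) where
  le := Relation.ReflTransGen WeakStep
  le_refl _ := Relation.ReflTransGen.refl
  le_trans _ _ _ := Relation.ReflTransGen.trans
  le_antisymm π σ h h' := by
    rcases Relation.ReflTransGen.cases_head h with rfl | ⟨ρ, h1, h2⟩
    · rfl
    · exact absurd (h1.2.trans_le (permLength_le_of_reflTransGen h2))
        (permLength_le_of_reflTransGen h').not_gt

theorem exists_weakStep_of_lt {n : ℕ} {π σ : Equiv.Perm (Fin n)} (h : π < σ) :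
    ∃ ρ, WeakStep π ρ ∧ ρ ≤ σ := by
  rcases Relation.ReflTransGen.cases_head h.le with rfl | ⟨ρ, h1, h2⟩
  · exact absurd h (lt_irrefl _)
  · exact ⟨ρ, h1, h2⟩

theorem WeakStep.lt {n : ℕ} {π σ : Equiv.Perm (Fin n)} (h : WeakStep π σ) : π < σ := by
  refine lt_of_le_of_ne (Relation.ReflTransGen.single h) ?_
  rintro rfl
  exact absurd h.2 (lt_irrefl _)

theorem permLength_strictMono {n : ℕ} :
    StrictMono (permLength : Equiv.Perm (Fin n) → ℕ) := by
  intro π σ h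
  obtain ⟨ρ, h1, h2⟩ := exists_weakStep_of_lt h
  exact h1.2.trans_le (permLength_le_of_reflTransGen h2)

theorem WeakStep.permLength_eq {n : ℕ} {π σ : Equiv.Perm (Fin n)} (h : WeakStep π σ) :
    permLength σ = permLength π + 1 := by
  obtain ⟨⟨i, hi, rfl⟩, hlt⟩ := h
  refine le_antisymm ?_ hlt
  set a : Fin n := ⟨i, by omega⟩
  set b : Fin n := ⟨i + 1, hi⟩
  have hswap : ∀ x y : Fin n, x < y → (x, y) ≠ (a, b) →
      Equiv.swap a b x < Equiv.swap a b y := by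
    intro x y hxy hne
    simp only [ne_eq, Prod.mk.injEq, not_and] at hne
    have hav : (a : ℕ) = i := rfl
    have hbv : (b : ℕ) = i + 1 := rfl
    clear_value a b
    simp only [Equiv.swap_apply_def]
    split_ifs <;> simp only [Fin.ext_iff, Fin.lt_def] at * <;> omega
  have hcard : ((inversions (π * Equiv.swap a b)).erase (a, b)).card ≤ permLength π := by
    refine Finset.card_le_card_of_injOn
      (fun p => (Equiv.swap a b p.1, Equiv.swap a b p.2)) ?_ ?_
    · rintro ⟨x, y⟩ hp
      obtain ⟨hne, hp⟩ := Finset.mem_erase.1 (Finset.mem_coe.1 hp)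
      have h := (Finset.mem_filter.1 hp).2
      exact Finset.mem_coe.2 (Finset.mem_filter.2 ⟨Finset.mem_univ _, hswap x y h.1 hne, h.2⟩)
    · rintro ⟨x, y⟩ _ ⟨x', y'⟩ _ h
      simpa using h
  have := Finset.pred_card_le_card_erase (s := inversions (π * Equiv.swap a b)) (a := (a, b))
  unfold permLength at *
  omega

/-- Every interval `[σ, τ]` of the weak order is a graded poset; the rank of `ρ` in it is
`ℓ(ρ) - ℓ(σ)`, so that its least element `σ` has rank `0`. -/
instance weakIntervalGrade {n : ℕ} (σ τ : Equiv.Perm (Fin n)) :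
    GradeMinOrder ℕ (Set.Icc σ τ) where
  grade ρ := permLength ρ.1 - permLength σ
  grade_strictMono := by
    intro x y h
    have h1 : permLength x.1 < permLength y.1 := permLength_strictMono h
    have h2 := permLength_strictMono.monotone x.2.1
    show permLength x.1 - permLength σ < permLength y.1 - permLength σ
    omega
  covBy_grade := by
    intro x y h
    obtain ⟨ρ, h1, h2⟩ := exists_weakStep_of_lt (show x.1 < y.1 from h.lt)
    have hρ : (⟨ρ, x.2.1.trans h1.lt.le, h2.trans y.2.2⟩ : Set.Icc σ τ) = y :=
      (h.eq_or_eq (show x.1 ≤ ρ from h1.lt.le) (show ρ ≤ y.1 from h2)).resolve_left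
        fun e => h1.lt.ne (congrArg Subtype.val e).symm
    have h3 : permLength y.1 = permLength x.1 + 1 := by rw [← hρ]; exact h1.permLength_eq
    have h4 := permLength_strictMono.monotone x.2.1
    rw [Nat.covBy_iff_add_one_eq]
    omega
  isMin_grade := by
    intro x h
    have : σ = x.1 := le_antisymm x.2.1
      (h (show (⟨σ, le_rfl, x.2.1.trans x.2.2⟩ : Set.Icc σ τ) ≤ x from x.2.1))
    simp [← this]

noncomputable instance weakIntervalFintype {n : ℕ} (σ τ : Equiv.Perm (Fin n)) :
    Fintype (Set.Icc σ τ) := Fintype.ofFinite _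

/-- The permutation `w₀ = n, n - 1, …, 1`. -/
def longestPerm (n : ℕ) : Equiv.Perm (Fin n) := Fin.revPerm

/-- `Λ_π = [id, π]` in the weak order. -/
abbrev lowerInterval {n : ℕ} (π : Equiv.Perm (Fin n)) : Set (Equiv.Perm (Fin n)) :=
  Set.Icc 1 π

/-- `V_π = [π, w₀]` in the weak order. -/
abbrev upperInterval {n : ℕ} (π : Equiv.Perm (Fin n)) : Set (Equiv.Perm (Fin n)) :=
  Set.Icc π (longestPerm n)

/-- A permutation is separable if it avoids the patterns `3142` and `2413`. -/
def IsSeparablePerm {n : ℕ} (π : Equiv.Perm (Fin n)) : Prop :=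
  ¬ ∃ i j k h : Fin n, i < j ∧ j < k ∧ k < h ∧
    ((π j < π h ∧ π h < π i ∧ π i < π k) ∨ (π k < π i ∧ π i < π h ∧ π h < π j))

section GradedPosets

variable (P : Type*) [PartialOrder P] [GradeMinOrder ℕ P] [Fintype P]

/-- The rank generating function `F(P, q) = ∑_{x ∈ P} q ^ rank(x)` of a finite graded poset. -/
noncomputable def rankGenFun : ℕ[X] := ∑ x : P, X ^ grade ℕ x

/-- The rank of a finite graded poset: the largest rank of an element. -/
def posetRank : ℕ := Finset.univ.sup fun x : P => grade ℕ x

/-- A finite poset is graded of rank `N` if all its maximal chains have length `N`, that is,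
`N + 1` elements. -/
def AllMaximalChainsOfRank : Prop := ∀ c : Flag P, (c : Set P).ncard = posetRank P + 1

/-- The number of elements of rank `i`. -/
def rankNumber (i : ℕ) : ℕ := (Finset.univ.filter fun x : P => grade ℕ x = i).card

/-- The rank numbers `p_0, …, p_N` (`N` the rank of `P`) satisfy `p_i = p_{N - i}`. -/
def RankSymmetric : Prop :=
  ∀ i ≤ posetRank P, rankNumber P i = rankNumber P (posetRank P - i)

/-- The rank numbers satisfy `p_0 ≤ ⋯ ≤ p_j ≥ ⋯ ≥ p_N` for some `j` (`N` the rank of `P`). -/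
def RankUnimodal : Prop :=
  ∃ j ≤ posetRank P, MonotoneOn (rankNumber P) (Set.Iic j) ∧
    AntitoneOn (rankNumber P) (Set.Icc j (posetRank P))

end GradedPosets

/-- A polynomial `c_0 + c_1 q + ⋯ + c_d q ^ d` of degree `d` is symmetric if `c_i = c_{d - i}`. -/
def SymmetricPoly (f : ℕ[X]) : Prop :=
  ∀ i ≤ f.natDegree, f.coeff i = f.coeff (f.natDegree - i)

/-- A polynomial of degree `d` is unimodal if `c_0 ≤ ⋯ ≤ c_j ≥ ⋯ ≥ c_d` for some `j`. -/
def UnimodalPoly (f : ℕ[X]) : Prop :=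
  ∃ j ≤ f.natDegree, MonotoneOn f.coeff (Set.Iic j) ∧
    AntitoneOn f.coeff (Set.Icc j f.natDegree)

/-! The rank numbers are weight multiplicities of a representation of sl₂. `SlTwoGraded` equips
`ℝ^P` with a raising operator whose transpose is the lowering operator. Positivity of the scalar
product makes raising injective below the middle rank (`SlTwoGraded.card_le_card_succ`), which
together with the reflection of ranks gives symmetry and unimodality. Unlike bare unimodality, the
structure passes to products (`SlTwoGraded.prod`).

The weak order is inclusion of sets of inverted pairs of letters (`weak_le_iff`), so `[1, π]` is
`InversionIdeal n f` with `f = π⁻¹`. Separability passes to inverses, and a separable word of length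
at least two is cut into two nonempty blocks, all values of one below all values of the other
(`SeparableWord.exists_split`). A permutation of `k + m` letters is a shuffle of a permutation of
the first `k` letters and one of the last `m`, and lengths add up (`permLength_shufflePerm`). If the
blocks of `f` increase, only the trivial shuffle is allowed; if they decrease, every shuffle is. As
a graded set the ideal is therefore a product of two smaller ideals and, in the decreasing case, of
the `k`-subsets of `k + m` points. Those carry the `k`-th exterior power of an irreducible
representation (`slTwoGraded_subsetsOfCard`). Induction on the length settles `Λ_π`.

Right multiplication by `w₀` complements inversion sets. It carries `V_π` to the ideal of `-f`,
again a separable word, with ranks reversed; the reflection restores their direction. -/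

open Matrix in
/-- A finite set `P` with rank function `r` carries an orthogonal `sl₂`-structure of highest weight
`N`: a raising operator `X` of degree one on `ℝ^P` with `[Xᵀ, X] = N - 2r`, and a bijection that
reflects ranks. -/
structure SlTwoGraded (P : Type*) [Fintype P] [DecidableEq P] (r : P → ℕ) (N : ℕ) : Prop where
  exists_raising : ∃ X : Matrix P P ℝ, (∀ a b, X a b ≠ 0 → r a = r b + 1) ∧
    Xᵀ * X - X * Xᵀ = diagonal fun a => (N : ℝ) - 2 * r a
  exists_reflection : ∃ φ : P ≃ P, ∀ a, r (φ a) + r a = N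

/-! ### Consequences and closure properties of sl₂-structures -/

namespace SlTwoGraded

open Matrix Kronecker

variable {P Q : Type*} [Fintype P] [DecidableEq P] [Fintype Q] [DecidableEq Q]
  {r : P → ℕ} {s : Q → ℕ} {N M : ℕ}

theorem le (h : SlTwoGraded P r N) (a : P) : r a ≤ N := by
  obtain ⟨φ, hφ⟩ := h.exists_reflection
  have := hφ a
  omega

theorem card_symm (h : SlTwoGraded P r N) {i : ℕ} (hi : i ≤ N) :
    (Finset.univ.filter fun a => r a = i).card =
      (Finset.univ.filter fun a => r a = N - i).card := by
  obtain ⟨φ, hφ⟩ := h.exists_reflection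
  refine Finset.card_equiv φ fun a => ?_
  have := hφ a
  simp only [Finset.mem_filter, Finset.mem_univ, true_and]
  omega

/-- If `v` lives in rank `i` and `X v = 0`, pairing the commutator relation with `v` gives `(N -
2i)|v|² = -|Xᵀ v|²`. The left side is nonnegative and the right side nonpositive, so `v = 0`:
raising from rank `i` is injective. -/
theorem card_le_card_succ (h : SlTwoGraded P r N) {i : ℕ} (hi : 2 * i < N) :
    (Finset.univ.filter fun a => r a = i).card ≤
      (Finset.univ.filter fun a => r a = i + 1).card := by
  obtain ⟨X, hX, hc⟩ := h.exists_raising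
  -- `E` extends by zero from rank `i`, and `L` is `X` from rank `i` to rank `i + 1`.
  let E : ({a // r a = i} → ℝ) →ₗ[ℝ] (P → ℝ) :=
    { toFun := fun v a => if h : r a = i then v ⟨a, h⟩ else 0
      map_add' := fun v w => by ext a; by_cases h : r a = i <;> simp [h]
      map_smul' := fun t v => by ext a; by_cases h : r a = i <;> simp [h] }
  let L : ({a // r a = i} → ℝ) →ₗ[ℝ] ({a // r a = i + 1} → ℝ) :=
    LinearMap.funLeft ℝ ℝ Subtype.val ∘ₗ X.mulVecLin ∘ₗ E
  have hL : Function.Injective L := by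
    rw [← LinearMap.ker_eq_bot, LinearMap.ker_eq_bot']
    intro v hv
    have hw : X *ᵥ E v = 0 := by
      ext a
      by_cases ha : r a = i + 1
      · exact congrFun hv ⟨a, ha⟩
      · refine Finset.sum_eq_zero fun b _ => ?_
        by_cases hb : r b = i
        · have : X a b = 0 := by
            by_contra h0
            exact ha (hb ▸ hX a b h0)
          simp [this]
        · simp [E, hb]
    have hD : (diagonal fun a => (N : ℝ) - 2 * r a) *ᵥ E v = ((N : ℝ) - 2 * i) • E v := by
      ext a
      rw [mulVec_diagonal]
      by_cases ha : r a = i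
      · simp [ha]
      · simp [E, ha]
    have h1 : E v ⬝ᵥ ((Xᵀ * X - X * Xᵀ) *ᵥ E v) = ((N : ℝ) - 2 * i) * (E v ⬝ᵥ E v) := by
      rw [hc, hD, dotProduct_smul, smul_eq_mul]
    have h2 : E v ⬝ᵥ ((Xᵀ * X - X * Xᵀ) *ᵥ E v) = -((Xᵀ *ᵥ E v) ⬝ᵥ (Xᵀ *ᵥ E v)) := by
      rw [sub_mulVec, ← mulVec_mulVec, hw, mulVec_zero, zero_sub, dotProduct_neg,
        ← mulVec_mulVec, dotProduct_mulVec, ← mulVec_transpose]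
    have h3 : 0 ≤ (Xᵀ *ᵥ E v) ⬝ᵥ (Xᵀ *ᵥ E v) := Finset.sum_nonneg fun _ _ => mul_self_nonneg _
    have h4 : 0 ≤ E v ⬝ᵥ E v := Finset.sum_nonneg fun _ _ => mul_self_nonneg _
    have h5 : (0 : ℝ) < (N : ℝ) - 2 * i := by
      have : (2 * i : ℝ) < N := by exact_mod_cast hi
      linarith
    have h6 : E v ⬝ᵥ E v = 0 := by nlinarith
    have h7 := dotProduct_self_eq_zero.1 h6
    ext ⟨a, ha⟩
    simpa [E, ha] using congrFun h7 a
  have := LinearMap.finrank_le_finrank_of_injective hL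
  simpa [Fintype.card_subtype] using this

theorem of_equiv (h : SlTwoGraded P r N) (e : Q ≃ P) (hs : ∀ b, r (e b) = s b) :
    SlTwoGraded Q s N := by
  obtain ⟨X, hX, hc⟩ := h.exists_raising
  obtain ⟨φ, hφ⟩ := h.exists_reflection
  refine ⟨⟨X.submatrix e e, fun a b hab => ?_, ?_⟩, (e.trans φ).trans e.symm, fun a => ?_⟩
  · rw [← hs, ← hs]
    exact hX _ _ hab
  · rw [transpose_submatrix, submatrix_mul_equiv, submatrix_mul_equiv]
    change (Xᵀ * X - X * Xᵀ).submatrix e e = _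
    rw [hc, submatrix_diagonal_equiv]
    congr 1
    ext a
    simp [hs]
  · rw [← hs, ← hs]
    simpa using hφ (e a)

/-- This is the tensor product of representations: `X ⊗ 1 + 1 ⊗ Y` raises, and the mixed terms of
the commutator cancel because `X ⊗ 1` commutes with `1 ⊗ Yᵀ`, and `Xᵀ ⊗ 1` with `1 ⊗ Y`. -/
theorem prod (h : SlTwoGraded P r N) (h' : SlTwoGraded Q s M) :
    SlTwoGraded (P × Q) (fun x => r x.1 + s x.2) (N + M) := by
  obtain ⟨X, hX, hc⟩ := h.exists_raising
  obtain ⟨φ, hφ⟩ := h.exists_reflection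
  obtain ⟨Y, hY, hd⟩ := h'.exists_raising
  obtain ⟨ψ, hψ⟩ := h'.exists_reflection
  refine ⟨⟨X ⊗ₖ (1 : Matrix Q Q ℝ) + (1 : Matrix P P ℝ) ⊗ₖ Y, ?_, ?_⟩, φ.prodCongr ψ, ?_⟩
  · rintro ⟨a, b⟩ ⟨a', b'⟩ hne
    simp only [Matrix.add_apply, kroneckerMap_apply, one_apply] at hne
    have : (X a a' ≠ 0 ∧ b = b') ∨ (a = a' ∧ Y b b' ≠ 0) := by
      by_contra hcon
      push Not at hcon
      apply hne
      by_cases h1 : b = b' <;> by_cases h2 : a = a' <;> simp_all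
    rcases this with ⟨h1, rfl⟩ | ⟨rfl, h1⟩
    · have := hX _ _ h1
      simp only; omega
    · have := hY _ _ h1
      simp only; omega
  · have key : (X ⊗ₖ (1 : Matrix Q Q ℝ) + (1 : Matrix P P ℝ) ⊗ₖ Y)ᵀ *
          (X ⊗ₖ (1 : Matrix Q Q ℝ) + (1 : Matrix P P ℝ) ⊗ₖ Y) -
        (X ⊗ₖ (1 : Matrix Q Q ℝ) + (1 : Matrix P P ℝ) ⊗ₖ Y) *
          (X ⊗ₖ (1 : Matrix Q Q ℝ) + (1 : Matrix P P ℝ) ⊗ₖ Y)ᵀ =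
        (Xᵀ * X - X * Xᵀ) ⊗ₖ (1 : Matrix Q Q ℝ) + (1 : Matrix P P ℝ) ⊗ₖ (Yᵀ * Y - Y * Yᵀ) := by
      rw [transpose_add, ← kroneckerMap_transpose, ← kroneckerMap_transpose, transpose_one,
        transpose_one, sub_eq_add_neg (Xᵀ * X), sub_eq_add_neg (Yᵀ * Y), add_kronecker,
        kronecker_add, ← neg_one_smul ℝ (X * Xᵀ), ← neg_one_smul ℝ (Y * Yᵀ), smul_kronecker,
        kronecker_smul]
      simp only [add_mul, mul_add, ← mul_kronecker_mul, one_mul, mul_one, neg_one_smul]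
      abel
    rw [key, hc, hd]
    ext ⟨a, b⟩ ⟨a', b'⟩
    simp only [Matrix.add_apply, kroneckerMap_apply, diagonal_apply, one_apply, Prod.mk.injEq]
    by_cases h1 : a = a' <;> by_cases h2 : b = b' <;> simp [h1, h2]
    ring
  · rintro ⟨a, b⟩
    have := hφ a
    have := hψ b
    simp only [Equiv.prodCongr_apply, Prod.map]
    omega

theorem of_unique [Unique P] (h : ∀ a, r a = 0) : SlTwoGraded P r 0 :=
  ⟨⟨0, by simp, by ext; simp [h]⟩, Equiv.refl P, by simp [h]⟩

end SlTwoGraded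

/-! ### The sl₂-structure on the `k`-subsets of a chain -/

section Subsets

open Matrix

/-- The `0`-`1` matrix of the partial map `g` with domain `p`. -/
def partialMapMatrix {P : Type*} [DecidableEq P] (p : P → Prop) [DecidablePred p] (g : P → P) :
    Matrix P P ℝ :=
  Matrix.of fun a b => if p b ∧ a = g b then 1 else 0

theorem partialMapMatrix_mul {P : Type*} [Fintype P] [DecidableEq P] (p q : P → Prop)
    [DecidablePred p] [DecidablePred q] (g h : P → P) :
    partialMapMatrix p g * partialMapMatrix q h =
      partialMapMatrix (fun b => q b ∧ p (h b)) (fun b => g (h b)) := by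
  ext a b
  simp only [partialMapMatrix, Matrix.mul_apply, Matrix.of_apply]
  rw [Finset.sum_eq_single (h b)]
  · by_cases h1 : q b <;> by_cases h2 : p (h b) <;> simp [h1, h2]
  · intro c _ hc
    simp [hc]
  · simp

theorem partialMapMatrix_congr {P : Type*} [DecidableEq P] {p q : P → Prop}
    [DecidablePred p] [DecidablePred q] {g h : P → P} (h1 : ∀ b, p b ↔ q b)
    (h2 : ∀ b, p b → g b = h b) : partialMapMatrix p g = partialMapMatrix q h := by
  ext a b
  simp only [partialMapMatrix, Matrix.of_apply]
  by_cases hb : p b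
  · simp [hb, (h1 b).1 hb, h2 b hb]
  · simp [hb, mt (h1 b).2 hb]

/-- The subsets of `Fin n` with `k` elements. -/
abbrev SubsetsOfCard (n k : ℕ) : Type := {S : Finset (Fin n) // S.card = k}

/-- The number of pairs `j < i` with `i ∈ S`, `j ∉ S`. -/
def shuffleRank {n : ℕ} (S : Finset (Fin n)) : ℕ :=
  ((S ×ˢ Sᶜ).filter fun p => p.2 < p.1).card

/-- Each `i ∈ S` has `i` points below it; those outside `S` are counted by the rank, and those
inside contribute `|S|(|S| - 1)/2` in total. Doubling and moving terms avoids division and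
subtraction in `ℕ`. -/
theorem two_mul_shuffleRank {n : ℕ} (S : Finset (Fin n)) :
    2 * shuffleRank S + S.card * S.card = 2 * ∑ i ∈ S, (i : ℕ) + S.card := by
  have h1 : shuffleRank S + ∑ i ∈ S, ∑ j ∈ S, (if j < i then 1 else 0) = ∑ i ∈ S, (i : ℕ) := by
    rw [shuffleRank, Finset.card_filter, Finset.sum_product, ← Finset.sum_add_distrib]
    refine Finset.sum_congr rfl fun i _ => ?_
    rw [add_comm, Finset.sum_add_sum_compl, ← Finset.card_filter]
    rw [← Fin.card_Iio]
    congr 1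
    ext x
    simp
  have h2 : ∑ i ∈ S, ∑ j ∈ S, (if j < i then 1 else 0) =
      ∑ i ∈ S, ∑ j ∈ S, (if i < j then 1 else 0) := Finset.sum_comm
  have h3 : ∑ i ∈ S, ∑ j ∈ S, (if j < i then 1 else 0) +
      ∑ i ∈ S, ∑ j ∈ S, (if i < j then 1 else 0) + S.card = S.card * S.card := by
    have : S.card = ∑ i ∈ S, ∑ j ∈ S, (if i = j then 1 else 0) := by
      simp
    conv_lhs => rw [this]
    rw [← Finset.sum_add_distrib, ← Finset.sum_add_distrib, ← smul_eq_mul, ← Finset.sum_const]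
    refine Finset.sum_congr rfl fun i _ => ?_
    rw [← Finset.sum_add_distrib, ← Finset.sum_add_distrib, Finset.card_eq_sum_ones]
    refine Finset.sum_congr rfl fun j _ => ?_
    rcases lt_trichotomy i j with h | h | h
    · simp [h, h.not_gt, h.ne]
    · simp [h]
    · simp [h, h.not_gt, h.ne']
  omega

variable {l k : ℕ}

/-- The exchange of `i` and `i + 1` on subsets. -/
def SubsetsOfCard.exchange (i : Fin l) (S : SubsetsOfCard (l + 1) k) : SubsetsOfCard (l + 1) k :=
  ⟨S.1.map (Equiv.swap i.castSucc i.succ).toEmbedding, by simp [S.2]⟩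

theorem SubsetsOfCard.mem_exchange (i : Fin l) (S : SubsetsOfCard (l + 1) k) (x : Fin (l + 1)) :
    x ∈ (S.exchange i).1 ↔ Equiv.swap i.castSucc i.succ x ∈ S.1 := by
  simp [SubsetsOfCard.exchange]

theorem SubsetsOfCard.exchange_exchange (i : Fin l) (S : SubsetsOfCard (l + 1) k) :
    (S.exchange i).exchange i = S := by
  ext x
  simp [SubsetsOfCard.mem_exchange]

theorem SubsetsOfCard.sum_exchange (i : Fin l) (S : SubsetsOfCard (l + 1) k)
    (h1 : i.castSucc ∈ S.1) (h2 : i.succ ∉ S.1) :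
    ∑ x ∈ (S.exchange i).1, (x : ℕ) = ∑ x ∈ S.1, (x : ℕ) + 1 := by
  rw [SubsetsOfCard.exchange, Finset.sum_map, ← Finset.add_sum_erase _ _ h1,
    ← Finset.add_sum_erase (a := i.castSucc) S.1 (fun x => (x : ℕ)) h1]
  have : ∑ x ∈ S.1.erase i.castSucc,
      (((Equiv.swap i.castSucc i.succ).toEmbedding x : Fin (l + 1)) : ℕ) =
      ∑ x ∈ S.1.erase i.castSucc, (x : ℕ) := by
    refine Finset.sum_congr rfl fun x hx => ?_
    rw [Finset.mem_erase] at hx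
    rw [Equiv.coe_toEmbedding, Equiv.swap_apply_of_ne_of_ne hx.1]
    rintro rfl
    exact h2 hx.2
  rw [this]
  simp
  omega

/-- `i ∈ S` and `i + 1 ∉ S`. -/
def SubsetsOfCard.CanRaise (i : Fin l) (S : SubsetsOfCard (l + 1) k) : Prop :=
  i.castSucc ∈ S.1 ∧ i.succ ∉ S.1

/-- `i + 1 ∈ S` and `i ∉ S`. -/
def SubsetsOfCard.CanLower (i : Fin l) (S : SubsetsOfCard (l + 1) k) : Prop :=
  i.succ ∈ S.1 ∧ i.castSucc ∉ S.1

instance (i : Fin l) : DecidablePred (SubsetsOfCard.CanRaise (k := k) i) := fun S =>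
  inferInstanceAs (Decidable (i.castSucc ∈ S.1 ∧ i.succ ∉ S.1))

instance (i : Fin l) : DecidablePred (SubsetsOfCard.CanLower (k := k) i) := fun S =>
  inferInstanceAs (Decidable (i.succ ∈ S.1 ∧ i.castSucc ∉ S.1))

theorem SubsetsOfCard.canRaise_exchange (i : Fin l) (S : SubsetsOfCard (l + 1) k) :
    (S.exchange i).CanRaise i ↔ S.CanLower i := by
  simp [SubsetsOfCard.CanRaise, SubsetsOfCard.CanLower, SubsetsOfCard.mem_exchange]

theorem SubsetsOfCard.canLower_exchange (i : Fin l) (S : SubsetsOfCard (l + 1) k) :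
    (S.exchange i).CanLower i ↔ S.CanRaise i := by
  simp [SubsetsOfCard.CanRaise, SubsetsOfCard.CanLower, SubsetsOfCard.mem_exchange]

/-- For neighbouring `i` and `j` neither composite is ever defined, since both moves compete for the
shared point. Otherwise the two exchanges have disjoint supports and commute. -/
theorem SubsetsOfCard.raise_lower_comm {i j : Fin l} (hij : i ≠ j) (S : SubsetsOfCard (l + 1) k) :
    (S.CanRaise i ∧ (S.exchange i).CanLower j ↔ S.CanLower j ∧ (S.exchange j).CanRaise i) ∧
    (S.CanRaise i ∧ (S.exchange i).CanLower j →
      (S.exchange i).exchange j = (S.exchange j).exchange i) := by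
  have hij' : (i : ℕ) ≠ j := fun h => hij (Fin.ext h)
  have e1 : i.castSucc ≠ j.castSucc := by simp [Fin.ext_iff, hij']
  have e2 : i.succ ≠ j.succ := by simp [Fin.ext_iff, hij']
  simp only [SubsetsOfCard.CanRaise, SubsetsOfCard.CanLower, SubsetsOfCard.mem_exchange]
  by_cases h1 : i.succ = j.castSucc
  · rw [← h1]
    rw [← h1] at e1
    have e3 : j.succ ≠ i.castSucc := by
      simp only [Fin.ext_iff, Fin.val_succ, Fin.val_castSucc, ne_eq] at h1 ⊢
      omega
    simp only [Equiv.swap_apply_right, Equiv.swap_apply_left]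
    tauto
  by_cases h2 : i.castSucc = j.succ
  · rw [← h2]
    simp only [Equiv.swap_apply_right, Equiv.swap_apply_left]
    tauto
  rw [Equiv.swap_apply_of_ne_of_ne (Ne.symm h2) (Ne.symm e2),
    Equiv.swap_apply_of_ne_of_ne (Ne.symm e1) (Ne.symm h1),
    Equiv.swap_apply_of_ne_of_ne e1 h2, Equiv.swap_apply_of_ne_of_ne h1 e2]
  refine ⟨by tauto, fun _ => ?_⟩
  ext x
  simp only [SubsetsOfCard.mem_exchange]
  have : Equiv.swap i.castSucc i.succ (Equiv.swap j.castSucc j.succ x) =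
      Equiv.swap j.castSucc j.succ (Equiv.swap i.castSucc i.succ x) := by
    simp only [Equiv.swap_apply_def]
    split_ifs <;> simp_all
  rw [this]

/-- The model is the `k`-th exterior power of the irreducible representation of dimension `l + 1`.
Moving one element to an adjacent free place never reorders a wedge of basis vectors, so no signs
occur. -/
theorem slTwoGraded_subsetsOfCard_succ (hk : k ≤ l + 1) :
    SlTwoGraded (SubsetsOfCard (l + 1) k) (fun S => shuffleRank S.1) (k * (l + 1 - k)) := by
  have hr : ∀ S : SubsetsOfCard (l + 1) k,
      2 * shuffleRank S.1 + k * k = 2 * ∑ i ∈ S.1, (i : ℕ) + k := fun S => by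
    have := two_mul_shuffleRank S.1
    rwa [S.2] at this
  refine ⟨?_, ?_⟩
  -- These are the matrix entries of the raising operator in an orthonormal weight basis. What is
  -- used is `c i ^ 2 - c (i - 1) ^ 2 = l - 2i`, the weight of the point `i`, where the formula for
  -- `c ^ 2` vanishes at both ends.
  · let c : Fin l → ℝ := fun i => Real.sqrt (((i : ℝ) + 1) * (l - i))
    have hc : ∀ i, c i * c i = ((i : ℝ) + 1) * (l - i) := fun i => by
      refine Real.mul_self_sqrt (mul_nonneg (by positivity) ?_)
      have : (i : ℝ) < l := by exact_mod_cast i.2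
      linarith
    let E : Fin l → Matrix (SubsetsOfCard (l + 1) k) (SubsetsOfCard (l + 1) k) ℝ :=
      fun i => partialMapMatrix (SubsetsOfCard.CanRaise i) (SubsetsOfCard.exchange i)
    have hEt : ∀ i, (E i)ᵀ =
        partialMapMatrix (SubsetsOfCard.CanLower i) (SubsetsOfCard.exchange i) := fun i => by
      ext S T
      simp only [E, transpose_apply, partialMapMatrix, of_apply]
      congr 1
      rw [eq_iff_iff]
      constructor
      · rintro ⟨h, rfl⟩
        exact ⟨(SubsetsOfCard.canLower_exchange _ _).2 h,
          (SubsetsOfCard.exchange_exchange _ _).symm⟩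
      · rintro ⟨h, rfl⟩
        exact ⟨(SubsetsOfCard.canRaise_exchange _ _).2 h,
          (SubsetsOfCard.exchange_exchange _ _).symm⟩
    have hcomm : ∀ i j, i ≠ j → (E j)ᵀ * E i - E i * (E j)ᵀ = 0 := fun i j hij => by
      rw [hEt, partialMapMatrix_mul, partialMapMatrix_mul, sub_eq_zero]
      exact partialMapMatrix_congr (fun S => (SubsetsOfCard.raise_lower_comm hij S).1)
        (fun S => (SubsetsOfCard.raise_lower_comm hij S).2)
    have hdiag : ∀ i, (E i)ᵀ * E i - E i * (E i)ᵀ = diagonal fun S =>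
        (if i.castSucc ∈ S.1 then 1 else 0) - (if i.succ ∈ S.1 then (1 : ℝ) else 0) := fun i => by
      rw [hEt, partialMapMatrix_mul, partialMapMatrix_mul]
      ext S T
      simp only [SubsetsOfCard.exchange_exchange, SubsetsOfCard.canRaise_exchange,
        SubsetsOfCard.canLower_exchange, and_self, partialMapMatrix, Matrix.sub_apply, of_apply,
        diagonal_apply]
      by_cases hST : S = T
      · subst hST
        by_cases h1 : i.castSucc ∈ S.1 <;> by_cases h2 : i.succ ∈ S.1 <;>
          simp [SubsetsOfCard.CanRaise, SubsetsOfCard.CanLower, h1, h2]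
      · simp [hST]
    refine ⟨∑ i, c i • E i, fun T S hTS => ?_, ?_⟩
    · rw [Matrix.sum_apply] at hTS
      obtain ⟨i, -, hi⟩ := Finset.exists_ne_zero_of_sum_ne_zero hTS
      have : S.CanRaise i ∧ T = S.exchange i := by
        by_contra hcon
        apply hi
        simp [E, partialMapMatrix, hcon]
      obtain ⟨⟨h1, h2⟩, rfl⟩ := this
      have h3 := S.sum_exchange i h1 h2
      have h4 := hr S
      have h5 := hr (S.exchange i)
      omega
    -- By `hcomm` only the terms with equal indices survive.
    · have : (∑ i, c i • E i)ᵀ * (∑ i, c i • E i) - (∑ i, c i • E i) * (∑ i, c i • E i)ᵀ =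
          ∑ i, (c i * c i) • ((E i)ᵀ * E i - E i * (E i)ᵀ) := by
        rw [transpose_sum, Finset.sum_mul_sum, Finset.sum_mul_sum, Finset.sum_comm,
          ← Finset.sum_sub_distrib]
        refine Finset.sum_congr rfl fun i _ => ?_
        rw [← Finset.sum_sub_distrib, Finset.sum_eq_single i]
        · rw [transpose_smul, smul_mul_smul_comm, smul_mul_smul_comm, ← smul_sub]
        · intro j _ hj
          rw [transpose_smul, smul_mul_smul_comm, smul_mul_smul_comm, mul_comm (c j), ← smul_sub,
            hcomm i j hj.symm, smul_zero]
        · simp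
      rw [this]
      ext S T
      simp only [hdiag, hc, Matrix.sum_apply, Matrix.smul_apply, diagonal_apply]
      by_cases hST : S = T
      swap
      · simp [hST]
      subst hST
      simp only [if_true, smul_eq_mul, mul_sub, Finset.sum_sub_distrib]
      -- Both sums extend to all `l + 1` points: the added summand is zero, at `i = l` here and at
      -- `i = 0` in `h2`. Their difference is then taken point by point.
      have h1 : ∑ i : Fin l, ((i : ℝ) + 1) * (l - i) * (if i.castSucc ∈ S.1 then 1 else 0) =
          ∑ i : Fin (l + 1), ((i : ℝ) + 1) * (l - i) * (if i ∈ S.1 then 1 else 0) := by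
        rw [Fin.sum_univ_castSucc]
        simp
      have h2 : ∑ i : Fin l, ((i : ℝ) + 1) * (l - i) * (if i.succ ∈ S.1 then 1 else 0) =
          ∑ i : Fin (l + 1), (i : ℝ) * (l + 1 - i) * (if i ∈ S.1 then 1 else 0) := by
        rw [Fin.sum_univ_succ]
        simp
      simp only [mul_sub] at h1 h2 ⊢
      rw [h1, h2]
      have h3 : ∑ i : Fin (l + 1), (l - 2 * (i : ℝ)) * (if i ∈ S.1 then 1 else 0) =
          k * l - 2 * ∑ i ∈ S.1, (i : ℝ) := by
        simp only [mul_ite, mul_one, mul_zero]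
        rw [← Finset.sum_filter, Finset.filter_univ_mem, Finset.sum_sub_distrib, Finset.sum_const,
          S.2, Finset.mul_sum, nsmul_eq_mul]
      have h4 : (2 * shuffleRank S.1 + k * k : ℝ) = 2 * ∑ i ∈ S.1, (i : ℝ) + k := by
        exact_mod_cast hr S
      have h5 : ((k * (l + 1 - k) : ℕ) : ℝ) = k * (l + 1 - k) := by
        push_cast [Nat.cast_sub hk]
        ring
      rw [h5, ← Finset.sum_sub_distrib]
      refine Eq.trans ?_ (h3.trans (by linarith))
      refine Finset.sum_congr rfl fun i _ => ?_
      ring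
  -- Replacing each `i` by `l - i` turns the sum of `S` into `k * l` minus that sum, which reflects
  -- the rank.
  · refine ⟨(Fin.revPerm.finsetCongr).subtypeEquiv fun S => by simp, fun S => ?_⟩
    have h1 : ∑ i ∈ S.1, (i : ℕ) + ∑ i ∈ S.1.map Fin.revPerm.toEmbedding, (i : ℕ) = k * l := by
      rw [Finset.sum_map, ← Finset.sum_add_distrib, Finset.sum_congr rfl (g := fun _ => l),
        Finset.sum_const, S.2, smul_eq_mul]
      intro i _
      simp [Fin.val_rev]
      omega
    have h2 := hr S
    have h3 := hr ⟨S.1.map Fin.revPerm.toEmbedding, by simp [S.2]⟩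
    simp only at h3
    have h4 : k * (l + 1 - k) + k * k = k * l + k := by
      rw [← mul_add, Nat.sub_add_cancel hk]
      ring
    simp only [Equiv.subtypeEquiv_apply, Equiv.finsetCongr_apply]
    omega

theorem slTwoGraded_subsetsOfCard {n k : ℕ} (hk : k ≤ n) :
    SlTwoGraded (SubsetsOfCard n k) (fun S => shuffleRank S.1) (k * (n - k)) := by
  cases n with
  | succ l => exact slTwoGraded_subsetsOfCard_succ hk
  | zero =>
    obtain rfl : k = 0 := by omega
    have : Unique (SubsetsOfCard 0 0) :=
      { default := ⟨∅, rfl⟩, uniq := fun S => Subsingleton.elim _ _ }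
    rw [zero_mul]
    exact SlTwoGraded.of_unique fun S => by simp [shuffleRank, Subsingleton.elim S.1 ∅]

end Subsets

/-! ### From sl₂-structures to rank numbers, generating functions and maximal chains -/

section GradedPosets

variable {P : Type*} [PartialOrder P] [GradeMinOrder ℕ P] [Fintype P]

theorem coeff_rankGenFun (i : ℕ) : (rankGenFun P).coeff i = rankNumber P i := by
  simp only [rankGenFun, finsetSum_coeff, coeff_X_pow, rankNumber, Finset.card_filter, eq_comm]

theorem SlTwoGraded.posetRank_eq [DecidableEq P] {N : ℕ} (h : SlTwoGraded P (grade ℕ) N)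
    (h0 : ∃ a : P, grade ℕ a = 0) : posetRank P = N := by
  obtain ⟨a, ha⟩ := h0
  refine le_antisymm (Finset.sup_le fun b _ => h.le b) ?_
  obtain ⟨φ, hφ⟩ := h.exists_reflection
  have h1 := hφ a
  have h2 : grade ℕ (φ a) ≤ posetRank P :=
    Finset.le_sup (f := fun x : P => grade ℕ x) (Finset.mem_univ _)
  omega

theorem SlTwoGraded.rankSymmetric [DecidableEq P] {N : ℕ} (h : SlTwoGraded P (grade ℕ) N)
    (h0 : ∃ a : P, grade ℕ a = 0) : RankSymmetric P := by
  intro i hi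
  rw [h.posetRank_eq h0] at hi ⊢
  exact h.card_symm hi

theorem SlTwoGraded.rankUnimodal [DecidableEq P] {N : ℕ} (h : SlTwoGraded P (grade ℕ) N)
    (h0 : ∃ a : P, grade ℕ a = 0) : RankUnimodal P := by
  have hup : ∀ i, 2 * i < N → rankNumber P i ≤ rankNumber P (i + 1) :=
    fun i hi => h.card_le_card_succ hi
  have hsymm : ∀ i ≤ N, rankNumber P i = rankNumber P (N - i) := fun i hi => h.card_symm hi
  -- The bound `N + 1` rather than `N` lets the chain of inequalities cross the two equal middle
  -- ranks when `N` is odd; the descending half needs this at `i = N / 2`.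
  have hmono : ∀ j i, i ≤ j → 2 * j ≤ N + 1 → rankNumber P i ≤ rankNumber P j := by
    intro j i hij
    induction j, hij using Nat.le_induction with
    | base => exact fun _ => le_rfl
    | succ j _ ih => exact fun hj => (ih (by omega)).trans (hup j (by omega))
  refine ⟨N / 2, ?_, fun i hi j hj hij => hmono j i hij ?_, fun i hi j hj hij => ?_⟩
  · rw [h.posetRank_eq h0]
    omega
  · have := Set.mem_Iic.1 hj
    omega
  · rw [h.posetRank_eq h0] at hi hj
    have h1 := hi.1
    have h2 := hi.2
    have h3 := hj.2
    rw [hsymm i h2, hsymm j h3]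
    exact hmono _ _ (by omega) (by omega)

theorem natDegree_rankGenFun : (rankGenFun P).natDegree ≤ posetRank P := by
  rw [rankGenFun]
  refine natDegree_sum_le_of_forall_le _ _ fun x _ => ?_
  rw [natDegree_X_pow]
  exact Finset.le_sup (f := fun x : P => grade ℕ x) (Finset.mem_univ _)

theorem natDegree_rankGenFun_eq [Nonempty P] : (rankGenFun P).natDegree = posetRank P := by
  refine le_antisymm natDegree_rankGenFun (le_natDegree_of_ne_zero ?_)
  obtain ⟨x, -, hx⟩ := Finset.exists_mem_eq_sup (Finset.univ : Finset P) Finset.univ_nonempty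
    fun x => grade ℕ x
  rw [coeff_rankGenFun, rankNumber]
  exact (Finset.card_pos.2 ⟨x, Finset.mem_filter.2 ⟨Finset.mem_univ _, hx.symm⟩⟩).ne'

theorem RankSymmetric.symmetricPoly [Nonempty P] (h : RankSymmetric P) :
    SymmetricPoly (rankGenFun P) := by
  intro i hi
  rw [natDegree_rankGenFun_eq] at hi ⊢
  rw [coeff_rankGenFun, coeff_rankGenFun]
  exact h i hi

theorem RankUnimodal.unimodalPoly [Nonempty P] (h : RankUnimodal P) :
    UnimodalPoly (rankGenFun P) := by
  have : (rankGenFun P).coeff = rankNumber P := funext coeff_rankGenFun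
  rw [UnimodalPoly, natDegree_rankGenFun_eq, this]
  exact h

/-- A maximal chain contains the bottom, and a cover inside it is a cover in `P`, so the grade
climbs by single steps until it reaches the top. The grade is injective on a chain, hence a
bijection onto `0, …, grade ⊤`. -/
theorem allMaximalChainsOfRank_of_bounded [BoundedOrder P] : AllMaximalChainsOfRank P := by
  intro c
  have hrank : posetRank P = grade ℕ (⊤ : P) :=
    le_antisymm (Finset.sup_le fun x _ => grade_mono le_top)
      (Finset.le_sup (f := fun x : P => grade ℕ x) (Finset.mem_univ _))
  have hsurj : ∀ i ≤ grade ℕ (⊤ : P), ∃ x : c, grade ℕ (x : P) = i := by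
    intro i
    induction i with
    | zero => exact fun _ => ⟨⟨⊥, c.bot_mem⟩, by simp⟩
    | succ i ih =>
      intro hi
      obtain ⟨x, hx⟩ := ih (by omega)
      have hlt : x < ⊤ := by
        refine lt_of_le_of_ne le_top ?_
        rintro rfl
        have : grade ℕ (⊤ : P) = i := hx
        omega
      obtain ⟨y, hxy, -⟩ := exists_covBy_le_of_lt hlt
      refine ⟨y, ?_⟩
      have := ((Flag.coe_covBy_coe.2 hxy).grade ℕ)
      rw [Nat.covBy_iff_add_one_eq] at this
      omega
  have himg : (fun x : P => grade ℕ x) '' (c : Set P) = Set.Iic (grade ℕ (⊤ : P)) := by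
    ext i
    constructor
    · rintro ⟨x, -, rfl⟩
      exact Set.mem_Iic.2 (grade_mono le_top)
    · intro hi
      obtain ⟨x, hx⟩ := hsurj i hi
      exact ⟨x, x.2, hx⟩
  have hinj : Set.InjOn (fun x : P => grade ℕ x) (c : Set P) := by
    intro x hx y hy hxy
    rcases c.le_or_le hx hy with h | h
    · exact h.eq_or_lt.resolve_right fun h' => (grade_strictMono h').ne hxy
    · exact (h.eq_or_lt.resolve_right fun h' => (grade_strictMono h').ne hxy.symm).symm
  rw [hrank, ← hinj.ncard_image, himg, ← Finset.coe_Iic, Set.ncard_coe_finset, Nat.card_Iic]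

end GradedPosets

/-! ### The weak order as inclusion of inversion sets -/

section WeakOrder

variable {n : ℕ}

/-- The inversions of `π`, as pairs of letters. -/
def valueInversions (π : Equiv.Perm (Fin n)) : Finset (Fin n × Fin n) :=
  Finset.univ.filter fun p => p.1 < p.2 ∧ π.symm p.2 < π.symm p.1

theorem mem_valueInversions {π : Equiv.Perm (Fin n)} {p : Fin n × Fin n} :
    p ∈ valueInversions π ↔ p.1 < p.2 ∧ π.symm p.2 < π.symm p.1 := by
  simp [valueInversions]

theorem card_valueInversions (π : Equiv.Perm (Fin n)) :
    (valueInversions π).card = permLength π := by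
  refine Finset.card_equiv ((Equiv.prodComm _ _).trans (π.symm.prodCongr π.symm)) ?_
  rintro ⟨a, b⟩
  simp [mem_valueInversions, inversions, and_comm]

/-- Exchanging adjacent positions changes the relative order of the two letters there and of no
other pair. Counting inversions by letters, not positions, makes this an insertion into a set. -/
theorem valueInversions_mul_swap (σ : Equiv.Perm (Fin n)) {i : ℕ} (hi : i + 1 < n)
    (h : σ ⟨i, by omega⟩ < σ ⟨i + 1, hi⟩) :
    valueInversions (σ * Equiv.swap ⟨i, by omega⟩ ⟨i + 1, hi⟩) =
      insert (σ ⟨i, by omega⟩, σ ⟨i + 1, hi⟩) (valueInversions σ) := by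
  set a : Fin n := ⟨i, by omega⟩
  set b : Fin n := ⟨i + 1, hi⟩
  have hav : (a : ℕ) = i := rfl
  have hbv : (b : ℕ) = i + 1 := rfl
  clear_value a b
  ext ⟨x, y⟩
  obtain ⟨u, rfl⟩ := σ.surjective x
  obtain ⟨v, rfl⟩ := σ.surjective y
  have hsymm : ∀ z, (σ * Equiv.swap a b).symm z = Equiv.swap a b (σ.symm z) := fun z => rfl
  simp only [Finset.mem_insert, mem_valueInversions, hsymm, Equiv.symm_apply_apply,
    Prod.mk.injEq, EmbeddingLike.apply_eq_iff_eq]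
  have key : σ u < σ v →
      (Equiv.swap a b v < Equiv.swap a b u ↔ (u = a ∧ v = b) ∨ v < u) := by
    intro huv
    have h1 : ¬ (u = b ∧ v = a) := by
      rintro ⟨rfl, rfl⟩
      exact huv.not_gt h
    simp only [Equiv.swap_apply_def]
    split_ifs <;> simp only [Fin.ext_iff, Fin.lt_def] at * <;> omega
  constructor
  · rintro ⟨h1, h2⟩
    rcases (key h1).1 h2 with h3 | h3
    · exact Or.inl h3
    · exact Or.inr ⟨h1, h3⟩
  · rintro (⟨rfl, rfl⟩ | ⟨h1, h2⟩)
    · exact ⟨h, (key h).2 (Or.inl ⟨rfl, rfl⟩)⟩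
    · exact ⟨h1, (key h1).2 (Or.inr h2)⟩

theorem WeakStep.valueInversions_subset {σ τ : Equiv.Perm (Fin n)} (h : WeakStep σ τ) :
    valueInversions σ ⊆ valueInversions τ := by
  obtain ⟨⟨i, hi, rfl⟩, hlt⟩ := h
  rcases lt_or_ge (σ ⟨i, by omega⟩) (σ ⟨i + 1, hi⟩) with h | h
  · rw [valueInversions_mul_swap σ hi h]
    exact Finset.subset_insert _ _
  · have hne : σ ⟨i + 1, hi⟩ ≠ σ ⟨i, by omega⟩ := by simp
    -- At a descent the exchange would remove an inversion, contradicting the increase in length.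
    have h' := valueInversions_mul_swap (σ * Equiv.swap ⟨i, Nat.lt_of_succ_lt hi⟩ ⟨i + 1, hi⟩) hi
      (by simpa using h.lt_of_ne hne)
    rw [mul_assoc, Equiv.swap_mul_self, mul_one] at h'
    have := Finset.card_le_card (h' ▸ Finset.subset_insert _ _ :
      valueInversions (σ * Equiv.swap ⟨i, Nat.lt_of_succ_lt hi⟩ ⟨i + 1, hi⟩) ⊆ valueInversions σ)
    rw [card_valueInversions, card_valueInversions] at this
    omega

/-- Otherwise `π⁻¹ σ` increases at every adjacent pair: at an ascent of `σ` by assumption, at a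
descent because its pair is an inversion of `σ` and so of `π`. The only increasing permutation is
the identity. -/
theorem exists_ascent_of_ne {σ π : Equiv.Perm (Fin n)} (hne : σ ≠ π)
    (h : valueInversions σ ⊆ valueInversions π) :
    ∃ (i : ℕ) (hi : i + 1 < n), σ ⟨i, by omega⟩ < σ ⟨i + 1, hi⟩ ∧
      (σ ⟨i, by omega⟩, σ ⟨i + 1, hi⟩) ∈ valueInversions π := by
  by_contra hcon
  push Not at hcon
  apply hne
  have hmono : StrictMono fun x => π.symm (σ x) := by
    cases n with
    | zero => exact fun x => x.elim0
    | succ m =>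
      rw [Fin.strictMono_iff_lt_succ]
      intro i
      have hi : (i : ℕ) + 1 < m + 1 := by omega
      have hne' : σ i.castSucc ≠ σ i.succ := by
        simp [Fin.ext_iff]
      rcases hne'.lt_or_gt with h1 | h1
      · have h2 := hcon i hi h1
        rw [mem_valueInversions] at h2
        have h3 : ¬ π.symm (σ i.succ) < π.symm (σ i.castSucc) := fun h3 => h2 ⟨h1, h3⟩
        refine lt_of_le_of_ne (not_lt.1 h3) ?_
        simpa using hne'
      · have h2 : (σ i.succ, σ i.castSucc) ∈ valueInversions σ := by
          rw [mem_valueInversions]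
          exact ⟨h1, by simp⟩
        exact (mem_valueInversions.1 (h h2)).2
  have hid : (fun x => π.symm (σ x)) = id := by
    have := Subsingleton.elim
      (hmono.orderIsoOfSurjective _ (π.symm.surjective.comp σ.surjective)) (OrderIso.refl _)
    funext x
    exact congrArg (fun e : Fin n ≃o Fin n => e x) this
  refine Equiv.ext fun x => π.symm.injective ?_
  rw [Equiv.symm_apply_apply]
  exact congrFun hid x

/-- For the converse, exchange at an ascent of `σ` whose pair is inverted in `π`. The inversion set
grows but stays inside that of `π`, and the difference of lengths drops. -/
theorem weak_le_iff {σ π : Equiv.Perm (Fin n)} :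
    σ ≤ π ↔ valueInversions σ ⊆ valueInversions π := by
  constructor
  · intro h
    induction (show Relation.ReflTransGen WeakStep σ π from h) with
    | refl => exact subset_rfl
    | tail h1 h2 ih => exact (ih h1).trans h2.valueInversions_subset
  · intro h
    induction hd : permLength π - permLength σ using Nat.strong_induction_on generalizing σ with
    | _ d ih =>
      by_cases hne : σ = π
      · exact hne.le
      obtain ⟨i, hi, h1, h2⟩ := exists_ascent_of_ne hne h
      have h3 := valueInversions_mul_swap σ hi h1
      set τ := σ * Equiv.swap ⟨i, by omega⟩ ⟨i + 1, hi⟩ with hτ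
      have h4 : permLength τ = permLength σ + 1 := by
        rw [← card_valueInversions, h3, Finset.card_insert_of_notMem, card_valueInversions]
        rw [mem_valueInversions]
        simp
      have h5 : valueInversions τ ⊆ valueInversions π := by
        rw [h3]
        exact Finset.insert_subset h2 h
      have h6 := Finset.card_le_card h5
      rw [card_valueInversions, card_valueInversions] at h6
      have hstep : WeakStep σ τ := ⟨⟨i, hi, hτ⟩, by omega⟩
      exact hstep.lt.le.trans (ih _ (by omega) h5 rfl)

theorem one_le_weak (π : Equiv.Perm (Fin n)) : 1 ≤ π := by
  rw [weak_le_iff]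
  rintro ⟨a, b⟩ h
  obtain ⟨h1, h2⟩ := mem_valueInversions.1 h
  exact absurd h1 (show b < a from h2).not_gt

theorem le_longestPerm (π : Equiv.Perm (Fin n)) : π ≤ longestPerm n := by
  rw [weak_le_iff]
  rintro ⟨a, b⟩ h
  have h1 := (mem_valueInversions.1 h).1
  exact mem_valueInversions.2 ⟨h1, by simpa [longestPerm] using h1⟩

theorem allMaximalChainsOfRank_Icc {σ τ : Equiv.Perm (Fin n)} (h : σ ≤ τ) :
    AllMaximalChainsOfRank (Set.Icc σ τ) := by
  let _ : BoundedOrder (Set.Icc σ τ) :=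
    { top := ⟨τ, h, le_rfl⟩
      bot := ⟨σ, le_rfl, h⟩
      le_top := fun x => x.2.2
      bot_le := fun x => x.2.1 }
  exact allMaximalChainsOfRank_of_bounded

/-- If the ranks of `[σ, τ]` carry an `sl₂`-structure, all the properties follow. -/
theorem SlTwoGraded.interval
    {σ τ : Equiv.Perm (Fin n)} [DecidableEq (Set.Icc σ τ)] (h : σ ≤ τ) {N : ℕ}
    (hs : SlTwoGraded (Set.Icc σ τ) (grade ℕ) N) :
    (SymmetricPoly (rankGenFun (Set.Icc σ τ)) ∧ UnimodalPoly (rankGenFun (Set.Icc σ τ))) ∧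
      AllMaximalChainsOfRank (Set.Icc σ τ) ∧ RankSymmetric (Set.Icc σ τ) ∧
        RankUnimodal (Set.Icc σ τ) := by
  have : Nonempty (Set.Icc σ τ) := ⟨⟨σ, le_rfl, h⟩⟩
  have h0 : ∃ a : Set.Icc σ τ, grade ℕ a = 0 :=
    ⟨⟨σ, le_rfl, h⟩, Nat.sub_self (permLength σ)⟩
  exact ⟨⟨(hs.rankSymmetric h0).symmetricPoly, (hs.rankUnimodal h0).unimodalPoly⟩,
    allMaximalChainsOfRank_Icc h, hs.rankSymmetric h0, hs.rankUnimodal h0⟩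

end WeakOrder

/-! ### Block decomposition of separable words -/

section Split

/-- The word `f 0, …, f (n - 1)` is injective and avoids the patterns `3142` and `2413`. -/
structure SeparableWord (f : ℕ → ℤ) (n : ℕ) : Prop where
  injOn : ∀ a < n, ∀ b < n, f a = f b → a = b
  avoids : ∀ a b c d, a < b → b < c → c < d → d < n →
    ¬ (f b < f d ∧ f d < f a ∧ f a < f c) ∧ ¬ (f c < f a ∧ f a < f d ∧ f d < f b)

/-- All of `f 0, …, f (k - 1)` are less than all of `f k, …, f (n - 1)`. -/
def SumSplit (f : ℕ → ℤ) (n k : ℕ) : Prop :=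
  0 < k ∧ k < n ∧ ∀ a < k, ∀ b, k ≤ b → b < n → f a < f b

theorem SeparableWord.neg {f : ℕ → ℤ} {n : ℕ} (h : SeparableWord f n) : SeparableWord (-f) n where
  injOn a ha b hb hab := h.injOn a ha b hb (neg_injective hab)
  avoids a b c d h1 h2 h3 h4 := by
    simp only [Pi.neg_apply, neg_lt_neg_iff]
    have := h.avoids a b c d h1 h2 h3 h4
    tauto

theorem SeparableWord.mono {f : ℕ → ℤ} {m n : ℕ} (h : SeparableWord f n) (hmn : m ≤ n) :
    SeparableWord f m where
  injOn a ha b hb := h.injOn a (by omega) b (by omega)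
  avoids a b c d h1 h2 h3 h4 := h.avoids a b c d h1 h2 h3 (by omega)

theorem SeparableWord.shift {f : ℕ → ℤ} {k m : ℕ} (h : SeparableWord f (k + m)) :
    SeparableWord (fun i => f (k + i)) m where
  injOn a ha b hb hab := by
    have := h.injOn (k + a) (by omega) (k + b) (by omega) hab
    omega
  avoids a b c d h1 h2 h3 h4 :=
    h.avoids (k + a) (k + b) (k + c) (k + d) (by omega) (by omega) (by omega) (by omega)

/-- Take the least cut `k` of the first `m` letters. If the new value `f m` exceeds the first block,
the cut `k` persists; if it is below that block, it is below everything and the cut is at `m`. A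
value falling strictly between values of the first block is excluded by splitting that block again.
-/
theorem SeparableWord.split_succ_of_sumSplit {f : ℕ → ℤ} {m : ℕ} (h : SeparableWord f (m + 1))
    (ih : ∀ k ≤ m, 2 ≤ k → ∃ j, SumSplit f k j ∨ SumSplit (-f) k j)
    (hm : ∃ k, SumSplit f m k) : ∃ k, SumSplit f (m + 1) k ∨ SumSplit (-f) (m + 1) k := by
  classical
  set k := Nat.find hm with hk
  obtain ⟨hk0, hkm, hsplit⟩ : SumSplit f m k := Nat.find_spec hm
  have hmin : ∀ j < k, ¬ SumSplit f m j := fun j hj => Nat.find_min hm hj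
  clear_value k
  have hne : ∀ a < m, f a ≠ f m := fun a ha hab => by
    have := h.injOn a (by omega) m (by omega) hab
    omega
  by_cases h1 : ∀ a < k, f a < f m
  · refine ⟨k, Or.inl ⟨hk0, by omega, fun a ha b hb hbm => ?_⟩⟩
    rcases Nat.lt_succ_iff_lt_or_eq.1 hbm with hbm | rfl
    · exact hsplit a ha b hb hbm
    · exact h1 a ha
  by_cases h2 : ∀ a < k, f m < f a
  · refine ⟨m, Or.inr ⟨by omega, by omega, fun a ha b hb hbm => ?_⟩⟩
    obtain rfl : b = m := by omega
    simp only [Pi.neg_apply, neg_lt_neg_iff]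
    by_cases hak : a < k
    · exact h2 a hak
    · exact (h2 0 hk0).trans (hsplit 0 hk0 a (by omega) ha)
  exfalso
  push Not at h1 h2
  obtain ⟨a0, ha0, h1⟩ := h1
  obtain ⟨a1, ha1, h2⟩ := h2
  have h1' : f m < f a0 := lt_of_le_of_ne h1 (hne a0 (by omega)).symm
  have hk2 : 2 ≤ k := by
    by_contra hlt
    obtain rfl : a0 = a1 := by omega
    omega
  obtain ⟨j, ⟨hj0, hjk, hj⟩ | ⟨hj0, hjk, hj⟩⟩ := ih k hkm.le hk2
  -- An increasing cut of the first block would also cut the first `m` letters, before `k`.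
  · refine hmin j hjk ⟨hj0, by omega, fun a ha b hb hbm => ?_⟩
    by_cases hbk : b < k
    · exact hj a ha b hb hbk
    · exact hsplit a (by omega) b (by omega) hbm
  · simp only [Pi.neg_apply, neg_lt_neg_iff] at hj
    obtain ⟨a, haj, ha⟩ : ∃ a < j, f m < f a := by
      by_cases h3 : a0 < j
      · exact ⟨a0, h3, h1'⟩
      · exact ⟨0, hj0, h1'.trans (hj 0 hj0 a0 (by omega) ha0)⟩
    -- If `f b < f m`, the positions `a < b < k < m` form a `3142`. So `f m` lies below the lower
    -- half `[j, k)` of the block, hence below all of it, contradicting `a1`.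
    have hb : ∀ b, j ≤ b → b < k → f m < f b := fun b hjb hbk => by
      refine lt_of_le_of_ne (not_lt.1 fun hlt => ?_) (hne b (by omega)).symm
      exact (h.avoids a b k m (by omega) hbk hkm (by omega)).1
        ⟨hlt, ha, hsplit a (by omega) k le_rfl hkm⟩
    have : f m < f a1 := by
      by_cases h3 : a1 < j
      · exact (hb j le_rfl hjk).trans (hj a1 h3 j le_rfl hjk)
      · exact hb a1 (by omega) ha1
    omega

/-- Split the word without its last letter and extend the cut; negation reduces decreasing cuts to
increasing ones. -/
theorem SeparableWord.exists_split {f : ℕ → ℤ} {n : ℕ} (h : SeparableWord f n) (hn : 2 ≤ n) :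
    ∃ k, SumSplit f n k ∨ SumSplit (-f) n k := by
  induction n using Nat.strong_induction_on generalizing f with
  | _ n ih =>
    obtain ⟨m, rfl⟩ : ∃ m, n = m + 1 := ⟨n - 1, by omega⟩
    by_cases hm : m = 1
    · subst hm
      have hne : f 0 ≠ f 1 := fun h01 => by
        have := h.injOn 0 (by omega) 1 (by omega) h01
        omega
      refine ⟨1, hne.lt_or_gt.imp (fun hlt => ?_) fun hlt => ?_⟩ <;>
      · refine ⟨by omega, by omega, fun a ha b hb hb2 => ?_⟩
        obtain rfl : a = 0 := by omega
        obtain rfl : b = 1 := by omega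
        simpa using hlt
    obtain ⟨k, hk | hk⟩ := ih m (by omega) (h.mono (by omega)) (by omega)
    · exact h.split_succ_of_sumSplit
        (fun k hk h2 => ih k (by omega) (h.mono (by omega)) h2) ⟨k, hk⟩
    · obtain ⟨j, hj⟩ := h.neg.split_succ_of_sumSplit
        (fun k hk h2 => ih k (by omega) (h.neg.mono (by omega)) h2) ⟨k, hk⟩
      rw [neg_neg] at hj
      exact ⟨j, hj.symm⟩

end Split

/-! ### Shuffles of permutations and the induction over blocks -/

section Shuffle

variable {k m : ℕ}

theorem SubsetsOfCard.card_compl (S : SubsetsOfCard (k + m) k) : (S.1)ᶜ.card = m := by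
  rw [Finset.card_compl, S.2, Fintype.card_fin, Nat.add_sub_cancel_left]

/-- The permutation with the first `k` letters in the positions of `S`, ordered as in `σ`, and the
other `m` letters in the positions outside `S`, ordered as in `τ`. -/
def shufflePerm (S : SubsetsOfCard (k + m) k) (σ : Equiv.Perm (Fin k)) (τ : Equiv.Perm (Fin m)) :
    Equiv.Perm (Fin (k + m)) :=
  ((finSumEquivOfFinset S.2 S.card_compl).symm.trans (σ.sumCongr τ)).trans finSumFinEquiv

theorem shufflePerm_symm_castAdd (S : SubsetsOfCard (k + m) k) (σ : Equiv.Perm (Fin k))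
    (τ : Equiv.Perm (Fin m)) (a : Fin k) :
    (shufflePerm S σ τ).symm (Fin.castAdd m a) = S.1.orderEmbOfFin S.2 (σ.symm a) := by
  simp [shufflePerm]

theorem shufflePerm_symm_natAdd (S : SubsetsOfCard (k + m) k) (σ : Equiv.Perm (Fin k))
    (τ : Equiv.Perm (Fin m)) (b : Fin m) :
    (shufflePerm S σ τ).symm (Fin.natAdd k b) =
      (S.1)ᶜ.orderEmbOfFin S.card_compl (τ.symm b) := by
  simp [shufflePerm]

/-- The shuffle determines `S` as the set of positions of the first `k` letters, and then both
orders. Surjectivity follows by counting: `(k + m).choose k * k! * m! = (k + m)!`. -/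
theorem shufflePerm_bijective : Function.Bijective
    fun x : SubsetsOfCard (k + m) k × Equiv.Perm (Fin k) × Equiv.Perm (Fin m) =>
      shufflePerm x.1 x.2.1 x.2.2 := by
  rw [Fintype.bijective_iff_injective_and_card]
  constructor
  · rintro ⟨S, σ, τ⟩ ⟨S', σ', τ'⟩ h
    simp only at h
    have h1 : ∀ a, S.1.orderEmbOfFin S.2 (σ.symm a) = S'.1.orderEmbOfFin S'.2 (σ'.symm a) :=
      fun a => by rw [← shufflePerm_symm_castAdd S σ τ, h, shufflePerm_symm_castAdd]
    have hS : S = S' := by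
      refine Subtype.ext (Finset.eq_of_subset_of_card_le (fun x hx => ?_) (by rw [S.2, S'.2]))
      obtain ⟨i, rfl⟩ : ∃ i, S.1.orderEmbOfFin S.2 i = x := by
        have : x ∈ Set.range (S.1.orderEmbOfFin S.2) := by
          rw [Finset.range_orderEmbOfFin]
          exact hx
        exact this
      rw [← σ.symm_apply_apply i, h1]
      exact Finset.orderEmbOfFin_mem _ _ _
    subst hS
    have h2 : ∀ b, (S.1)ᶜ.orderEmbOfFin S.card_compl (τ.symm b) =
        (S.1)ᶜ.orderEmbOfFin S.card_compl (τ'.symm b) :=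
      fun b => by rw [← shufflePerm_symm_natAdd S σ τ, h, shufflePerm_symm_natAdd]
    have h3 : σ = σ' := Equiv.symm_bijective.injective
      (Equiv.ext fun a => (S.1.orderEmbOfFin S.2).injective (h1 a))
    have h4 : τ = τ' := Equiv.symm_bijective.injective
      (Equiv.ext fun b => ((S.1)ᶜ.orderEmbOfFin S.card_compl).injective (h2 b))
    rw [h3, h4]
  · rw [Fintype.card_prod, Fintype.card_prod, Fintype.card_perm, Fintype.card_perm,
      Fintype.card_perm, Fintype.card_finset_len, Fintype.card_fin, Fintype.card_fin,
      Fintype.card_fin, ← mul_assoc]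
    simpa using Nat.choose_mul_factorial_mul_factorial (Nat.le_add_right k m)

theorem sum_orderEmbOfFin {n : ℕ} (S : Finset (Fin n)) (h : S.card = k) (g : Fin n → ℕ) :
    ∑ i, g (S.orderEmbOfFin h i) = ∑ x ∈ S, g x := by
  conv_rhs => rw [← Finset.map_orderEmbOfFin_univ S h, Finset.sum_map]
  rfl

theorem permLength_eq_sum {n : ℕ} (π : Equiv.Perm (Fin n)) :
    permLength π = ∑ a, ∑ b, if a < b ∧ π.symm b < π.symm a then 1 else 0 := by
  rw [← card_valueInversions, valueInversions, Finset.card_filter, Fintype.sum_prod_type]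

theorem castAdd_lt_natAdd (a : Fin k) (b : Fin m) : Fin.castAdd m a < Fin.natAdd k b := by
  simp only [Fin.lt_def, Fin.val_castAdd, Fin.val_natAdd]
  omega

theorem castAdd_lt_castAdd_iff {a b : Fin k} : Fin.castAdd m a < Fin.castAdd m b ↔ a < b := Iff.rfl

/-- Inverted pairs within a block are those of `σ` or `τ`, because the position embeddings are
increasing; pairs across the blocks are counted by `shuffleRank`. -/
theorem permLength_shufflePerm (S : SubsetsOfCard (k + m) k) (σ : Equiv.Perm (Fin k))
    (τ : Equiv.Perm (Fin m)) :
    permLength (shufflePerm S σ τ) = shuffleRank S.1 + (permLength σ + permLength τ) := by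
  have h2 : ∑ a : Fin k, ∑ b : Fin m, (if (S.1)ᶜ.orderEmbOfFin S.card_compl (τ.symm b) <
      S.1.orderEmbOfFin S.2 (σ.symm a) then 1 else 0) = shuffleRank S.1 := by
    rw [σ.symm.sum_comp fun a => ∑ b : Fin m, (if (S.1)ᶜ.orderEmbOfFin S.card_compl (τ.symm b) <
      S.1.orderEmbOfFin S.2 a then 1 else 0)]
    rw [sum_orderEmbOfFin S.1 S.2 fun x => ∑ b : Fin m,
      (if (S.1)ᶜ.orderEmbOfFin S.card_compl (τ.symm b) < x then 1 else 0), shuffleRank,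
      Finset.card_filter, Finset.sum_product]
    refine Finset.sum_congr rfl fun x _ => ?_
    rw [τ.symm.sum_comp fun b => (if (S.1)ᶜ.orderEmbOfFin S.card_compl b < x then 1 else 0)]
    rw [sum_orderEmbOfFin (S.1)ᶜ S.card_compl fun y => if y < x then 1 else 0]
  rw [permLength_eq_sum, permLength_eq_sum σ, permLength_eq_sum τ, ← h2]
  simp only [Fin.sum_univ_add, shufflePerm_symm_castAdd, shufflePerm_symm_natAdd, castAdd_lt_natAdd,
    (castAdd_lt_natAdd _ _).not_gt, true_and, false_and, if_false, OrderEmbedding.lt_iff_lt,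
    castAdd_lt_castAdd_iff, Fin.natAdd_lt_natAdd_iff, Finset.sum_add_distrib,
    Finset.sum_const_zero]
  ring

/-- The permutations all of whose inversions are inversions of the word `f 0, …, f (n - 1)`; for
`f = π⁻¹` it is the interval `[1, π]`. -/
abbrev InversionIdeal (n : ℕ) (f : ℕ → ℤ) : Type :=
  {ρ : Equiv.Perm (Fin n) // ∀ p ∈ valueInversions ρ, f p.2 < f p.1}

/-- `hQ` says that the condition on pairs across the blocks depends on `S` alone, which makes the
ideal a product of three factors. -/
theorem SlTwoGraded.of_shuffle {f : ℕ → ℤ} {Q : SubsetsOfCard (k + m) k → Prop} [DecidablePred Q]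
    {N₀ N₁ N₂ : ℕ} (h₀ : SlTwoGraded {S // Q S} (fun S => shuffleRank S.1.1) N₀)
    (h₁ : SlTwoGraded (InversionIdeal k f) (fun σ => permLength σ.1) N₁)
    (h₂ : SlTwoGraded (InversionIdeal m fun i => f (k + i)) (fun τ => permLength τ.1) N₂)
    (hQ : ∀ S σ τ, Q S ↔ ∀ (a : Fin k) (b : Fin m),
      (shufflePerm S σ τ).symm (Fin.natAdd k b) < (shufflePerm S σ τ).symm (Fin.castAdd m a) →
        f (k + b) < f a) :
    SlTwoGraded (InversionIdeal (k + m) f) (fun ρ => permLength ρ.1) (N₀ + (N₁ + N₂)) := by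
  have hmem : ∀ S σ τ, (∀ p ∈ valueInversions (shufflePerm S σ τ), f p.2 < f p.1) ↔
      Q S ∧ (∀ p ∈ valueInversions σ, f p.2 < f p.1) ∧
        ∀ p ∈ valueInversions τ, f (k + p.2) < f (k + p.1) := fun S σ τ => by
    rw [hQ S σ τ]
    simp only [Prod.forall, mem_valueInversions, Fin.forall_fin_add, shufflePerm_symm_castAdd,
      shufflePerm_symm_natAdd, castAdd_lt_natAdd,
    (castAdd_lt_natAdd _ _).not_gt, true_and, false_and, OrderEmbedding.lt_iff_lt,
      castAdd_lt_castAdd_iff, Fin.natAdd_lt_natAdd_iff, Fin.val_castAdd, Fin.val_natAdd,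
      false_imp_iff, forall_and, implies_true]
    tauto
  let e : {S // Q S} × InversionIdeal k f × InversionIdeal m (fun i => f (k + i)) →
      InversionIdeal (k + m) f := fun x =>
    ⟨shufflePerm x.1.1 x.2.1.1 x.2.2.1, (hmem _ _ _).2 ⟨x.1.2, x.2.1.2, x.2.2.2⟩⟩
  have he : Function.Bijective e := by
    constructor
    · rintro ⟨⟨S, _⟩, ⟨σ, _⟩, ⟨τ, _⟩⟩ ⟨⟨S', _⟩, ⟨σ', _⟩, ⟨τ', _⟩⟩ h
      have := shufflePerm_bijective.injective
        (a₁ := (S, σ, τ)) (a₂ := (S', σ', τ')) (congrArg Subtype.val h)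
      simp only [Prod.mk.injEq] at this
      obtain ⟨rfl, rfl, rfl⟩ := this
      rfl
    · rintro ⟨ρ, hρ⟩
      obtain ⟨⟨S, σ, τ⟩, rfl⟩ := shufflePerm_bijective.surjective ρ
      obtain ⟨h1, h2, h3⟩ := (hmem S σ τ).1 hρ
      exact ⟨(⟨S, h1⟩, ⟨σ, h2⟩, ⟨τ, h3⟩), rfl⟩
  refine (h₀.prod (h₁.prod h₂)).of_equiv (Equiv.ofBijective e he).symm fun ρ => ?_
  obtain ⟨x, rfl⟩ := (Equiv.ofBijective e he).surjective ρ
  rw [Equiv.symm_apply_apply]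
  exact (permLength_shufflePerm _ _ _).symm

theorem SlTwoGraded.of_skewSplit {f : ℕ → ℤ} {N₁ N₂ : ℕ}
    (h₁ : SlTwoGraded (InversionIdeal k f) (fun σ => permLength σ.1) N₁)
    (h₂ : SlTwoGraded (InversionIdeal m fun i => f (k + i)) (fun τ => permLength τ.1) N₂)
    (hf : ∀ a < k, ∀ b < m, f (k + b) < f a) :
    SlTwoGraded (InversionIdeal (k + m) f) (fun ρ => permLength ρ.1)
      (k * (k + m - k) + (N₁ + N₂)) := by
  have h₀ : SlTwoGraded {S : SubsetsOfCard (k + m) k // True} (fun S => shuffleRank S.1.1)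
      (k * (k + m - k)) :=
    (slTwoGraded_subsetsOfCard (Nat.le_add_right k m)).of_equiv
      (Equiv.subtypeUnivEquiv fun _ => trivial) fun _ => rfl
  exact h₀.of_shuffle h₁ h₂ fun S σ τ => by
    simpa using fun (a : Fin k) (b : Fin m) _ => hf a a.2 b b.2

/-- Sets of rank zero are initial segments, and these are comparable under inclusion. -/
theorem eq_of_shuffleRank_eq_zero {n : ℕ} {S T : Finset (Fin n)} (hS : shuffleRank S = 0)
    (hT : shuffleRank T = 0) (h : S.card = T.card) : S = T := by
  have hlower : ∀ {U : Finset (Fin n)}, shuffleRank U = 0 → ∀ x ∈ U, ∀ y < x, y ∈ U := by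
    intro U hU x hx y hy
    by_contra hyU
    rw [shuffleRank, Finset.card_eq_zero, Finset.filter_eq_empty_iff] at hU
    exact hU (Finset.mk_mem_product hx (Finset.mem_compl.2 hyU)) hy
  by_cases hST : S ⊆ T
  · exact Finset.eq_of_subset_of_card_le hST h.ge
  · obtain ⟨x, hxS, hxT⟩ := Finset.not_subset.1 hST
    refine (Finset.eq_of_subset_of_card_le (fun y hy => ?_) h.le).symm
    refine hlower hS x hxS y (lt_of_le_of_ne (not_lt.1 fun hlt => hxT ?_) ?_)
    · exact hlower hT y hy x hlt
    · rintro rfl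
      exact hxT hy

theorem SlTwoGraded.of_sumSplit {f : ℕ → ℤ} {N₁ N₂ : ℕ}
    (h₁ : SlTwoGraded (InversionIdeal k f) (fun σ => permLength σ.1) N₁)
    (h₂ : SlTwoGraded (InversionIdeal m fun i => f (k + i)) (fun τ => permLength τ.1) N₂)
    (hf : ∀ a < k, ∀ b < m, f a < f (k + b)) :
    SlTwoGraded (InversionIdeal (k + m) f) (fun ρ => permLength ρ.1) (0 + (N₁ + N₂)) := by
  have hS₀ : shuffleRank (Finset.univ.map (Fin.castAddEmb (n := k) m)) = 0 := by
    rw [shuffleRank, Finset.card_eq_zero, Finset.filter_eq_empty_iff]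
    rintro ⟨x, y⟩ hxy hlt
    rw [Finset.mem_product, Finset.mem_map, Finset.mem_compl] at hxy
    obtain ⟨⟨a, -, rfl⟩, hy⟩ := hxy
    refine hy (Finset.mem_map.2 ⟨⟨y, ?_⟩, Finset.mem_univ _, rfl⟩)
    exact lt_trans (Fin.lt_def.1 hlt) a.2
  have : Unique {S : SubsetsOfCard (k + m) k // shuffleRank S.1 = 0} :=
    { default := ⟨⟨Finset.univ.map (Fin.castAddEmb m), by simp⟩, hS₀⟩
      uniq := fun S => Subtype.ext <| Subtype.ext <|
        eq_of_shuffleRank_eq_zero S.2 hS₀ (by rw [S.1.2]; simp) }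
  have h₀ : SlTwoGraded {S : SubsetsOfCard (k + m) k // shuffleRank S.1 = 0}
      (fun S => shuffleRank S.1.1) 0 := SlTwoGraded.of_unique fun S => S.2
  refine h₀.of_shuffle h₁ h₂ fun S σ τ => ?_
  rw [shuffleRank, Finset.card_eq_zero, Finset.filter_eq_empty_iff]
  simp only [shufflePerm_symm_castAdd, shufflePerm_symm_natAdd]
  constructor
  · intro h a b hab
    exact absurd hab (h (Finset.mk_mem_product (Finset.orderEmbOfFin_mem _ _ _)
      (Finset.orderEmbOfFin_mem _ _ _)))
  · rintro h ⟨x, y⟩ hxy hlt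
    obtain ⟨hx, hy⟩ := Finset.mem_product.1 hxy
    rw [← Finset.mem_coe, ← Finset.range_orderEmbOfFin _ S.2] at hx
    rw [← Finset.mem_coe, ← Finset.range_orderEmbOfFin _ S.card_compl] at hy
    obtain ⟨i, rfl⟩ := hx
    obtain ⟨j, rfl⟩ := hy
    have := h (σ i) (τ j) (by simpa using hlt)
    exact absurd this (hf _ (σ i).2 _ (τ j).2).not_gt

theorem SeparableWord.exists_slTwoGraded {f : ℕ → ℤ} {n : ℕ} (h : SeparableWord f n) :
    ∃ N, SlTwoGraded (InversionIdeal n f) (fun ρ => permLength ρ.1) N := by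
  induction n using Nat.strong_induction_on generalizing f with
  | _ n ih =>
    by_cases hn : n < 2
    · have hsub : Subsingleton (Fin n) := Fin.subsingleton_iff_le_one.2 (by omega)
      have h0 : ∀ ρ : Equiv.Perm (Fin n), valueInversions ρ = ∅ := fun ρ =>
        Finset.filter_eq_empty_iff.2 fun p _ hp => hp.1.ne (Subsingleton.elim _ _)
      have : Unique (InversionIdeal n f) :=
        { default := ⟨1, by simp [h0]⟩
          uniq := fun _ => Subsingleton.elim _ _ }
      exact ⟨0, SlTwoGraded.of_unique fun ρ => by
        rw [← card_valueInversions, h0, Finset.card_empty]⟩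
    obtain ⟨k, hk⟩ := h.exists_split (by omega)
    obtain ⟨m, rfl⟩ : ∃ m, n = k + m := ⟨n - k, by
      rcases hk with hk | hk <;> have := hk.2.1 <;> omega⟩
    have hk0 : 0 < k := hk.elim (fun h => h.1) fun h => h.1
    have hkm : k < k + m := hk.elim (fun h => h.2.1) fun h => h.2.1
    obtain ⟨N₁, h₁⟩ := ih k hkm (h.mono hkm.le)
    obtain ⟨N₂, h₂⟩ := ih m (by omega) h.shift
    rcases hk with hk | hk
    · exact ⟨_, h₁.of_sumSplit h₂ fun a ha b hb => hk.2.2 a ha _ (by omega) (by omega)⟩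
    · exact ⟨_, h₁.of_skewSplit h₂ fun a ha b hb =>
        neg_lt_neg_iff.1 (hk.2.2 a ha (k + b) (by omega) (by omega))⟩

end Shuffle

/-! ### The intervals `Λ_π` and `V_π` as inversion ideals -/

section Intervals

variable {n : ℕ}

/-- The positions of the letters of `π`, extended by `0` to a function on `ℕ`. -/
def positionWord (π : Equiv.Perm (Fin n)) (i : ℕ) : ℤ :=
  if h : i < n then ((π.symm ⟨i, h⟩ : Fin n) : ℤ) else 0

theorem positionWord_lt_iff (π : Equiv.Perm (Fin n)) (a b : Fin n) :
    positionWord π a < positionWord π b ↔ π.symm a < π.symm b := by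
  simp [positionWord]

/-- The patterns `3142` and `2413` are inverse to each other, so an occurrence of one in `π⁻¹`
yields the other in `π`. -/
theorem IsSeparablePerm.separableWord {π : Equiv.Perm (Fin n)} (hπ : IsSeparablePerm π) :
    SeparableWord (positionWord π) n where
  injOn a ha b hb hab := by
    have h : π.symm ⟨a, ha⟩ = π.symm ⟨b, hb⟩ := Fin.ext <| by
      simpa only [positionWord, ha, hb, dif_pos, Nat.cast_inj] using hab
    exact congrArg Fin.val (π.symm.injective h)
  avoids a b c d h1 h2 h3 h4 := by
    have key := fun x y : Fin n => positionWord_lt_iff π x y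
    constructor
    · rintro ⟨hbd, hda, hac⟩
      refine hπ ⟨π.symm ⟨b, by omega⟩, π.symm ⟨d, h4⟩, π.symm ⟨a, by omega⟩, π.symm ⟨c, by omega⟩,
        (key _ _).1 hbd, (key _ _).1 hda, (key _ _).1 hac, Or.inr ?_⟩
      simp only [Equiv.apply_symm_apply, Fin.mk_lt_mk]
      exact ⟨h1, h2, h3⟩
    · rintro ⟨hca, had, hdb⟩
      refine hπ ⟨π.symm ⟨c, by omega⟩, π.symm ⟨a, by omega⟩, π.symm ⟨d, h4⟩, π.symm ⟨b, by omega⟩,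
        (key _ _).1 hca, (key _ _).1 had, (key _ _).1 hdb, Or.inl ?_⟩
      simp only [Equiv.apply_symm_apply, Fin.mk_lt_mk]
      exact ⟨h1, h2, h3⟩

theorem mem_lowerInterval_iff {π ρ : Equiv.Perm (Fin n)} :
    ρ ∈ lowerInterval π ↔
      ∀ p ∈ valueInversions ρ, positionWord π p.2 < positionWord π p.1 := by
  rw [lowerInterval, Set.mem_Icc, and_iff_right (one_le_weak ρ), weak_le_iff]
  simp only [positionWord_lt_iff]
  exact forall₂_congr fun p hp => by
    rw [mem_valueInversions, and_iff_right (mem_valueInversions.1 hp).1]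

theorem mem_valueInversions_mul_revPerm {ρ : Equiv.Perm (Fin n)} {p : Fin n × Fin n} :
    p ∈ valueInversions (ρ * Fin.revPerm) ↔ p.1 < p.2 ∧ p ∉ valueInversions ρ := by
  have h : ∀ x, (ρ * Fin.revPerm).symm x = Fin.rev (ρ.symm x) := fun _ => rfl
  rw [mem_valueInversions, mem_valueInversions, h, h, Fin.rev_lt_rev]
  refine and_congr_right fun hp => ?_
  have : ρ.symm p.1 ≠ ρ.symm p.2 := by simpa using hp.ne
  rw [and_iff_right hp, not_lt]
  exact ⟨le_of_lt, fun h => lt_of_le_of_ne h this⟩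

/-- Containing the inversions of `π` means that the non-inversions of `ρ`, which are the inversions
of `ρ w₀`, are non-inversions of `π`. -/
theorem mem_upperInterval_iff {π ρ : Equiv.Perm (Fin n)} :
    ρ ∈ upperInterval π ↔ ∀ p ∈ valueInversions (ρ * Fin.revPerm),
      (-positionWord π) p.2 < (-positionWord π) p.1 := by
  rw [upperInterval, Set.mem_Icc, and_iff_left (le_longestPerm ρ), weak_le_iff]
  simp only [Pi.neg_apply, neg_lt_neg_iff, positionWord_lt_iff, mem_valueInversions_mul_revPerm]
  refine ⟨fun h p hp => ?_, fun h p hp => ?_⟩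
  · refine lt_of_le_of_ne (not_lt.1 fun hlt => ?_) (by simpa using hp.1.ne)
    exact hp.2 (h (mem_valueInversions.2 ⟨hp.1, hlt⟩))
  · by_contra hcon
    have hp' := mem_valueInversions.1 hp
    exact (h p ⟨hp'.1, hcon⟩).not_gt hp'.2

theorem permLength_add_permLength_mul_revPerm (ρ : Equiv.Perm (Fin n)) :
    permLength ρ + permLength (ρ * Fin.revPerm) =
      (Finset.univ.filter fun p : Fin n × Fin n => p.1 < p.2).card := by
  rw [← card_valueInversions, ← card_valueInversions,
    ← Finset.card_union_of_disjoint]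
  · congr 1
    ext p
    simp only [Finset.mem_union, mem_valueInversions_mul_revPerm, Finset.mem_filter,
      Finset.mem_univ, true_and]
    have : p ∈ valueInversions ρ → p.1 < p.2 := fun h => (mem_valueInversions.1 h).1
    tauto
  · rw [Finset.disjoint_left]
    exact fun p hp hp' => (mem_valueInversions_mul_revPerm.1 hp').2 hp

theorem IsSeparablePerm.slTwoGraded_lowerInterval {π : Equiv.Perm (Fin n)}
    [DecidableEq (lowerInterval π)] (hπ : IsSeparablePerm π) :
    ∃ N, SlTwoGraded (lowerInterval π) (grade ℕ) N := by
  obtain ⟨N, h⟩ := hπ.separableWord.exists_slTwoGraded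
  refine ⟨N, h.of_equiv (Equiv.subtypeEquivRight fun ρ => mem_lowerInterval_iff) fun ρ => ?_⟩
  have h1 : permLength (1 : Equiv.Perm (Fin n)) = 0 := by
    rw [permLength, Finset.card_eq_zero, inversions, Finset.filter_eq_empty_iff]
    exact fun p _ hp => hp.1.not_gt hp.2
  change permLength ρ.1 = permLength ρ.1 - permLength 1
  rw [h1, Nat.sub_zero]

theorem IsSeparablePerm.slTwoGraded_upperInterval {π : Equiv.Perm (Fin n)}
    [DecidableEq (upperInterval π)] (hπ : IsSeparablePerm π) :
    ∃ N, SlTwoGraded (upperInterval π) (grade ℕ) N := by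
  obtain ⟨N, h⟩ := hπ.separableWord.neg.exists_slTwoGraded
  obtain ⟨φ, hφ⟩ := h.exists_reflection
  let e : upperInterval π ≃ InversionIdeal n (-positionWord π) :=
    (Equiv.mulRight Fin.revPerm).subtypeEquiv fun ρ => mem_upperInterval_iff
  have he : ∀ ρ, permLength ρ.1 + permLength (e ρ).1 =
      (Finset.univ.filter fun p : Fin n × Fin n => p.1 < p.2).card := fun ρ =>
    permLength_add_permLength_mul_revPerm ρ.1
  have hle : ∀ ρ : upperInterval π, permLength π ≤ permLength ρ.1 := fun ρ =>
    permLength_strictMono.monotone ρ.2.1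
  set M := (Finset.univ.filter fun p : Fin n × Fin n => p.1 < p.2).card
  -- The image of `π` under `e` has length `M - ℓ(π)`, which is at most `N`. Conversely the image of
  -- `w₀` has length `0`, so its reflection has length `N`; this is `e ρ` for some `ρ ≥ π`, hence `N
  -- = M - ℓ(ρ) ≤ M - ℓ(π)`.
  have hN : permLength π + N = M := by
    have h1 := he ⟨π, le_rfl, le_longestPerm π⟩
    have h2 := h.le (e ⟨π, le_rfl, le_longestPerm π⟩)
    have h3 : permLength (longestPerm n) = M := by
      rw [← card_valueInversions]
      congr 1
      ext p
      simp [mem_valueInversions, longestPerm]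
    have h4 := he ⟨longestPerm n, le_longestPerm π, le_rfl⟩
    have h5 := hφ (e ⟨longestPerm n, le_longestPerm π, le_rfl⟩)
    obtain ⟨ρ, hρ⟩ := e.surjective (φ (e ⟨longestPerm n, le_longestPerm π, le_rfl⟩))
    have h6 := he ρ
    have h7 := hle ρ
    rw [hρ] at h6
    simp only at h1 h2 h4
    omega
  -- `e` reverses ranks; composing with the reflection `φ` makes the bijection preserve them.
  refine ⟨N, h.of_equiv (e.trans φ) fun ρ => ?_⟩
  have h1 := he ρ
  have h2 := hφ (e ρ)
  have h3 := hle ρ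
  change permLength (φ (e ρ)).1 = permLength ρ.1 - permLength π
  omega

end Intervals

theorem corollary3p9 {n : ℕ} (π : Equiv.Perm (Fin n)) (hπ : IsSeparablePerm π) :
    (SymmetricPoly (rankGenFun (lowerInterval π)) ∧
      UnimodalPoly (rankGenFun (lowerInterval π))) ∧
    (SymmetricPoly (rankGenFun (upperInterval π)) ∧
      UnimodalPoly (rankGenFun (upperInterval π))) ∧
    (AllMaximalChainsOfRank (lowerInterval π) ∧ RankSymmetric (lowerInterval π) ∧
      RankUnimodal (lowerInterval π)) ∧
    (AllMaximalChainsOfRank (upperInterval π) ∧ RankSymmetric (upperInterval π) ∧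
      RankUnimodal (upperInterval π)) := by
  classical
  obtain ⟨N, hN⟩ := hπ.slTwoGraded_lowerInterval
  obtain ⟨M, hM⟩ := hπ.slTwoGraded_upperInterval
  have h1 := hN.interval (one_le_weak π)
  have h2 := hM.interval (le_longestPerm π)
  exact ⟨h1.1, h2.1, h1.2, h2.2⟩
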